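/- Let $k,\ell,m,n\ge 0$ be integers, $0<\alpha\le 1$, and let $S_1,\dots,S_m$ be independently scattered positive $\alpha$-stable random measures on $\mathbb R^k$ with Lebesgue control measure, standardized so that $E[e^{-\theta S_j(A)}]=e^{-|A|\theta^\alpha}$ for $\theta\ge 0$ and every Borel set $A$ of finite Lebesgue measure $|A|$. That is, each $S_j$ is a random set function on the Borel sets of finite Lebesgue measure which is almost surely nonnegative and (for each fixed sequence of disjoint sets whose union has finite Lebesgue measure) almost surely countably additive, takes independent values on disjoint sets, and has the stated Laplace transforms. For nonnegative $f\in L_\alpha(\mathbb R^k)$, $\int f(s)\,S_j(ds)$ denotes the stochastic integral: the limit in probability of the integrals of nonnegative simple functions, supported on sets of finite Lebesgue measure, converging to $f$ in $L_\alpha$. Let $t_1,\dots,t_n\in\mathbb R^\ell$, and let $\mu_{t_i}\in\mathbb R$ and $\sigma_{t_i}>0$. Let $G_{t_i}$ be a Gumbel$(\mu_{t_i},\sigma_{t_i})$ variable, i.e. $P(G_{t_i}\le x)=\exp(-e^{-(x-\mu_{t_i})/\sigma_{t_i}})$ for all $x\in\mathbb R$, and suppose that $S_1,\dots,S_m,G_{t_1},\dots,G_{t_n}$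 are mutually independent. Let $f_j(t,s)\ge 0$ ($t\in\mathbb R^\ell$, $s\in\mathbb R^k$, $1\le j\le m$) be functions such that $f_j(t_i,\cdot)\in L_\alpha(\mathbb R^k)$ for all $i,j$, and suppose that $$X_{t_i}=G_{t_i}+\sigma_{t_i}\log\Big(\sum_{j=1}^m\int f_j(t_i,s)\,S_j(ds)\Big)\quad\text{almost surely},\qquad i=1,\dots,n,$$ with values in $[-\infty,\infty)$, where $\log 0=-\infty$. Then, for all $x_1,\dots,x_n\in\mathbb R$, $$P(X_{t_i}\le x_i,\ i=1,\dots,n)=\prod_{j=1}^m\exp\Big(-\int_{\mathbb R^k}\Big(\sum_{i=1}^n f_j(t_i,s)\,e^{-(x_i-\mu_{t_i})/\sigma_{t_i}}\Big)^{\alpha}\,ds\Big).$$ -/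

import Mathlib

open MeasureTheory ProbabilityTheory Filter
open scoped Topology ENNReal

noncomputable section

/-- `Y` is a random variable with the Gumbel distribution with location `μ` and scale `σ`,
i.e. with distribution function `x ↦ exp (-e^{-(x - μ)/σ})`. -/
structure IsGumbel {Ω : Type*} [MeasurableSpace Ω] (P : Measure Ω) (μ σ : ℝ) (Y : Ω → ℝ) :
    Prop where
  measurable : Measurable Y
  cdf : ∀ x : ℝ, P.real {ω | Y ω ≤ x} = Real.exp (-Real.exp (-((x - μ) / σ)))

/-- `M` is a standardized, independently scattered, positive `α`-stable random measure (noise)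
on `ℝᵏ` with Lebesgue control measure: a random set function on the Borel sets of finite Lebesgue
measure which is almost surely nonnegative and countably additive, independent on disjoint sets,
and such that `M A` is positive `α`-stable with Laplace transform `θ ↦ exp (-|A| θ^α)`.
(Values of `M` on sets that are not Borel or have infinite measure play no role.) -/
structure IsPositiveStableNoise {Ω : Type*} [MeasurableSpace Ω] (P : Measure Ω) (α : ℝ) {k : ℕ}
    (M : Set (EuclideanSpace ℝ (Fin k)) → Ω → ℝ) : Prop where
  measurable : ∀ A, MeasurableSet A → volume A < ∞ → Measurable (M A)
  nonneg : ∀ A, MeasurableSet A → volume A < ∞ → ∀ᵐ ω ∂P, 0 ≤ M A ω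
  indep : ∀ (n : ℕ) (A : Fin n → Set (EuclideanSpace ℝ (Fin k))),
    (∀ i, MeasurableSet (A i)) → (∀ i, volume (A i) < ∞) → Pairwise (Function.onFun Disjoint A) →
      iIndepFun (fun i => M (A i)) P
  additive : ∀ A : ℕ → Set (EuclideanSpace ℝ (Fin k)),
    (∀ i, MeasurableSet (A i)) → volume (⋃ i, A i) < ∞ → Pairwise (Function.onFun Disjoint A) →
      ∀ᵐ ω ∂P, HasSum (fun i => M (A i) ω) (M (⋃ i, A i) ω)
  laplace : ∀ A, MeasurableSet A → volume A < ∞ → ∀ θ : ℝ, 0 ≤ θ →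
    ∫ ω, Real.exp (-(θ * M A ω)) ∂P = Real.exp (-(volume.real A * θ ^ α))

/-- The σ-algebra generated by the noise `M`, i.e. by the variables `M A` with `A` a Borel set of
finite Lebesgue measure. -/
@[reducible] def noiseSigmaAlgebra {Ω : Type*} {k : ℕ} (M : Set (EuclideanSpace ℝ (Fin k)) → Ω → ℝ) :
    MeasurableSpace Ω :=
  ⨆ (A : Set (EuclideanSpace ℝ (Fin k))) (_ : MeasurableSet A) (_ : volume A < ∞),
    MeasurableSpace.comap (M A) (inferInstance : MeasurableSpace ℝ)

/-- The integral of a simple function against the noise: the sum of `c * M {g = c}` over the values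
`c` of `g` (the value `c = 0` contributes nothing). -/
def simpleNoiseIntegral {Ω : Type*} {k : ℕ} (M : Set (EuclideanSpace ℝ (Fin k)) → Ω → ℝ)
    (g : SimpleFunc (EuclideanSpace ℝ (Fin k)) ℝ) (ω : Ω) : ℝ :=
  ∑ c ∈ g.range, c * M (g ⁻¹' {c}) ω

/-- The random variable `I` is a version of the stochastic integral `∫ f(s) M(ds)` of the
nonnegative function `f`: it is the limit in probability of the integrals of nonnegative simple
functions, with supports of finite Lebesgue measure, that converge to `f` in `L_α`. -/
def IsNoiseIntegral {Ω : Type*} [MeasurableSpace Ω] (P : Measure Ω) (α : ℝ) {k : ℕ}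
    (M : Set (EuclideanSpace ℝ (Fin k)) → Ω → ℝ) (f : EuclideanSpace ℝ (Fin k) → ℝ)
    (I : Ω → ℝ) : Prop :=
  Measurable I ∧
  ∃ g : ℕ → SimpleFunc (EuclideanSpace ℝ (Fin k)) ℝ,
    (∀ n s, 0 ≤ g n s) ∧
    (∀ n, volume (Function.support (g n)) < ∞) ∧
    Tendsto (fun n => eLpNorm (fun s => g n s - f s) (ENNReal.ofReal α) volume) atTop (𝓝 0) ∧
    TendstoInMeasure P (fun n => simpleNoiseIntegral M (g n)) atTop I

open scoped Classical in
/-- The stochastic integral `∫ f(s) M(ds)` of a nonnegative function (it is determined up to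
almost sure equality, and it exists for nonnegative `f ∈ L_α`). -/
def noiseIntegral {Ω : Type*} [MeasurableSpace Ω] (P : Measure Ω) (α : ℝ) {k : ℕ}
    (M : Set (EuclideanSpace ℝ (Fin k)) → Ω → ℝ) (f : EuclideanSpace ℝ (Fin k) → ℝ) : Ω → ℝ :=
  if h : ∃ I, IsNoiseIntegral P α M f I then h.choose else 0

/-- The logarithm of a nonnegative real number, with `log 0 = -∞`. -/
def extLog (y : ℝ) : EReal := ENNReal.log (ENNReal.ofReal y)

end

/-! Put `c i = exp (-((x i - μ i) / σ i))`. Shifting a Gumbel variable by `σ * log w` multiplies the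
inner exponential of its distribution function by `w`, so conditionally on the noises the
probability of the event is `∏ i, exp (-c i * W i)`, where `W i` is the sum over `j` of the
integrals of `f j (t i)` (`measure_forall_gumbel_le`). The exponents add up, and exchanging the sums
over `i` and `j` turns this into a product over `j` of `exp (-I j)`, where `I j` is the integral of
`∑ i, c i * f j (t i)` against `S j`, by linearity (`IsNoiseIntegral.sum`). Independence of the
noises factors the expectation, and each factor is the Laplace functional `E exp (-∫ f dM) = exp (-∫
f ^ α)` (`IsNoiseIntegral.laplace`), which holds for simple functions by independent scattering and
passes to the limit. Two further points need proof: the integral exists, so `noiseIntegral` is not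
its default value `0` (`exists_isNoiseIntegral`), and it has a version measurable for the σ-algebra
of the noise, to which the independence hypothesis refers (`exists_measurable`). -/

/-! ### Integrals of simple functions -/

theorem SimpleFunc.measure_fiber_lt_top {X : Type*} [MeasurableSpace X] {ν : Measure X}
    {g : SimpleFunc X ℝ} (hg : ν (Function.support g) < ∞) {c : ℝ} (hc : c ≠ 0) :
    ν (g ⁻¹' {c}) < ∞ :=
  (measure_mono fun x hx => by simp_all).trans_lt hg

theorem measurable_simpleNoiseIntegral {Ω : Type*} {k : ℕ}
    (M : Set (EuclideanSpace ℝ (Fin k)) → Ω → ℝ)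
    {g : SimpleFunc (EuclideanSpace ℝ (Fin k)) ℝ} (hg : volume (Function.support g) < ∞) :
    Measurable[noiseSigmaAlgebra M] (simpleNoiseIntegral M g) := by
  refine Finset.measurable_fun_sum _ fun c _ => ?_
  rcases eq_or_ne c 0 with rfl | hc
  · simp
  · refine Measurable.const_mul (Measurable.mono (comap_measurable (M (g ⁻¹' {c}))) ?_ le_rfl) c
    exact le_iSup₂_of_le (g ⁻¹' {c}) (g.measurableSet_fiber c)
      (le_iSup_of_le (SimpleFunc.measure_fiber_lt_top hg hc) le_rfl)

namespace IsPositiveStableNoise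

variable {Ω : Type*} [MeasurableSpace Ω] {P : Measure Ω} {α : ℝ} {k : ℕ}
  {M : Set (EuclideanSpace ℝ (Fin k)) → Ω → ℝ}

theorem ae_empty (hM : IsPositiveStableNoise P α M) : ∀ᵐ ω ∂P, M ∅ ω = 0 := by
  have h := hM.additive (fun _ => ∅) (fun _ => MeasurableSet.empty) (by simp)
    (fun _ _ _ => by simp [Function.onFun])
  filter_upwards [h] with ω hω
  exact (summable_const_iff _).1 hω.summable

theorem ae_union (hM : IsPositiveStableNoise P α M) {A B : Set (EuclideanSpace ℝ (Fin k))}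
    (hA : MeasurableSet A) (hB : MeasurableSet B) (hA' : volume A < ∞) (hB' : volume B < ∞)
    (hAB : Disjoint A B) : ∀ᵐ ω ∂P, M (A ∪ B) ω = M A ω + M B ω := by
  let C : ℕ → Set (EuclideanSpace ℝ (Fin k)) := fun n => if n = 0 then A else if n = 1 then B else ∅
  have hU : ⋃ i, C i = A ∪ B := by
    ext x
    simp only [Set.mem_iUnion, Set.mem_union, C]
    constructor
    · rintro ⟨i, hi⟩
      split_ifs at hi
      · exact Or.inl hi
      · exact Or.inr hi
      · exact hi.elim
    · rintro (h | h)
      · exact ⟨0, by simpa using h⟩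
      · exact ⟨1, by simpa using h⟩
  have h := hM.additive C (fun i => by dsimp only [C]; split_ifs <;> simp [hA, hB])
    (by rw [hU]; exact measure_union_lt_top hA' hB')
    (fun i j hij => by
      dsimp only [Function.onFun, C]
      split_ifs <;> first | omega | exact hAB | exact hAB.symm | simp)
  filter_upwards [h, hM.ae_empty] with ω hω h0
  rw [hU] at hω
  have h2 : HasSum (fun i => M (C i) ω) (∑ i ∈ ({0, 1} : Finset ℕ), M (C i) ω) :=
    hasSum_sum_of_ne_finset_zero (fun i hi => by
    simp only [Finset.mem_insert, Finset.mem_singleton, not_or] at hi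
    simp [C, hi.1, hi.2, h0])
  refine (hω.unique h2).trans ?_
  rw [Finset.sum_pair zero_ne_one]
  simp [C]

theorem ae_biUnion (hM : IsPositiveStableNoise P α M) {ι : Type*} (s : Finset ι)
    (A : ι → Set (EuclideanSpace ℝ (Fin k))) (hA : ∀ i ∈ s, MeasurableSet (A i))
    (hA' : ∀ i ∈ s, volume (A i) < ∞) (hd : Pairwise (Function.onFun Disjoint A)) :
    ∀ᵐ ω ∂P, M (⋃ i ∈ s, A i) ω = ∑ i ∈ s, M (A i) ω := by
  classical
  induction s using Finset.induction_on with
  | empty => simpa using hM.ae_empty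
  | insert i s hi ih =>
    have h1 := ih (fun j hj => hA j (Finset.mem_insert_of_mem hj))
      (fun j hj => hA' j (Finset.mem_insert_of_mem hj))
    have h2 := hM.ae_union (hA i (Finset.mem_insert_self i s))
      (s.measurableSet_biUnion fun j hj => hA j (Finset.mem_insert_of_mem hj))
      (hA' i (Finset.mem_insert_self i s))
      ((measure_biUnion_lt_top s.finite_toSet fun j hj => hA' j (Finset.mem_insert_of_mem hj)))
      (Set.disjoint_iUnion₂_right.2 fun j hj => hd (by rintro rfl; exact hi hj))
    filter_upwards [h1, h2] with ω h1 h2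
    rw [Finset.set_biUnion_insert, h2, h1, Finset.sum_insert hi]

/-- The integral of `φ ∘ h` can be computed along the level sets of the simple function `h`. -/
theorem simpleNoiseIntegral_map (hM : IsPositiveStableNoise P α M) {β : Type*}
    (h : SimpleFunc (EuclideanSpace ℝ (Fin k)) β) (φ : β → ℝ)
    (hfin : ∀ b ∈ h.range, φ b ≠ 0 → volume (h ⁻¹' {b}) < ∞) :
    ∀ᵐ ω ∂P, simpleNoiseIntegral M (h.map φ) ω = ∑ b ∈ h.range, φ b * M (h ⁻¹' {b}) ω := by
  classical
  -- The value `0` is treated apart: its level set may have infinite measure, where nothing is known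
  -- about `M`.
  have key : ∀ c ∈ (h.map φ).range, ∀ᵐ ω ∂P,
      c * M ((h.map φ) ⁻¹' {c}) ω = ∑ b ∈ h.range with φ b = c, φ b * M (h ⁻¹' {b}) ω := by
    intro c _
    rcases eq_or_ne c 0 with rfl | hc
    · refine ae_of_all _ fun ω => ?_
      rw [zero_mul, Finset.sum_eq_zero]
      intro b hb
      rw [(Finset.mem_filter.1 hb).2, zero_mul]
    · have hU : (h.map φ) ⁻¹' {c} = ⋃ b ∈ h.range.filter (fun b => φ b = c), h ⁻¹' {b} := by
        ext x
        simp
      filter_upwards [hM.ae_biUnion (h.range.filter (fun b => φ b = c)) (fun b => h ⁻¹' {b})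
        (fun b _ => h.measurableSet_fiber b)
        (fun b hb => hfin b (Finset.mem_filter.1 hb).1
          (by rw [(Finset.mem_filter.1 hb).2]; exact hc))
        (fun a b hab => Disjoint.preimage h (by simpa using hab))] with ω hω
      rw [hU, hω, Finset.mul_sum]
      exact Finset.sum_congr rfl fun b hb => by rw [(Finset.mem_filter.1 hb).2]
  have key' := (ae_ball_iff (Finset.countable_toSet (h.map φ).range)).2 key
  filter_upwards [key'] with ω hω
  rw [simpleNoiseIntegral, Finset.sum_congr rfl hω]
  exact Finset.sum_fiberwise_of_maps_to (fun b hb => by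
    rw [SimpleFunc.range_map]; exact Finset.mem_image_of_mem _ hb) _

theorem noiseSigmaAlgebra_le (hM : IsPositiveStableNoise P α M) :
    noiseSigmaAlgebra M ≤ ‹MeasurableSpace Ω› :=
  iSup₂_le fun A hA => iSup_le fun hA' => (hM.measurable A hA hA').comap_le

theorem simpleNoiseIntegral_nonneg (hM : IsPositiveStableNoise P α M)
    {g : SimpleFunc (EuclideanSpace ℝ (Fin k)) ℝ} (hg : volume (Function.support g) < ∞)
    (h0 : ∀ s, 0 ≤ g s) : ∀ᵐ ω ∂P, 0 ≤ simpleNoiseIntegral M g ω := by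
  have key : ∀ c ∈ g.range, ∀ᵐ ω ∂P, 0 ≤ c * M (g ⁻¹' {c}) ω := by
    intro c hc
    rcases eq_or_ne c 0 with rfl | hc0
    · simp
    obtain ⟨s, rfl⟩ := SimpleFunc.mem_range.1 hc
    filter_upwards [hM.nonneg _ (g.measurableSet_fiber (g s))
      (SimpleFunc.measure_fiber_lt_top hg hc0)] with ω hω
    exact mul_nonneg (h0 s) hω
  filter_upwards [(ae_ball_iff (Finset.countable_toSet g.range)).2 key] with ω hω
  exact Finset.sum_nonneg hω

/-- The level sets of `g.pair h` refine those of `g`, `h` and `g + h`, so all three integrals become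
sums over one partition. -/
theorem simpleNoiseIntegral_add (hM : IsPositiveStableNoise P α M)
    {g h : SimpleFunc (EuclideanSpace ℝ (Fin k)) ℝ} (hg : volume (Function.support g) < ∞)
    (hh : volume (Function.support h) < ∞) :
    ∀ᵐ ω ∂P, simpleNoiseIntegral M (g + h) ω =
      simpleNoiseIntegral M g ω + simpleNoiseIntegral M h ω := by
  have hfin : ∀ b : ℝ × ℝ, b ≠ 0 → volume (g.pair h ⁻¹' {b}) < ∞ := by
    intro b hb
    refine (measure_mono ?_).trans_lt (measure_union_lt_top hg hh)
    rintro x rfl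
    simp only [SimpleFunc.pair_apply, ne_eq, Prod.mk_eq_zero, not_and_or] at hb
    exact hb
  filter_upwards [hM.simpleNoiseIntegral_map (g.pair h) (fun b => b.1 + b.2)
      (fun b _ hb => hfin b (by rintro rfl; simp at hb)),
    hM.simpleNoiseIntegral_map (g.pair h) Prod.fst
      (fun b _ hb => hfin b (by rintro rfl; simp at hb)),
    hM.simpleNoiseIntegral_map (g.pair h) Prod.snd
      (fun b _ hb => hfin b (by rintro rfl; simp at hb))] with ω h1 h2 h3
  rw [SimpleFunc.map_fst_pair] at h2
  rw [SimpleFunc.map_snd_pair] at h3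
  rw [h2, h3, ← Finset.sum_add_distrib, SimpleFunc.add_eq_map₂, h1]
  exact Finset.sum_congr rfl fun b _ => by ring

theorem simpleNoiseIntegral_const_mul (hM : IsPositiveStableNoise P α M) (a : ℝ)
    {g : SimpleFunc (EuclideanSpace ℝ (Fin k)) ℝ} (hg : volume (Function.support g) < ∞) :
    ∀ᵐ ω ∂P, simpleNoiseIntegral M (g.map (a * ·)) ω = a * simpleNoiseIntegral M g ω := by
  filter_upwards [hM.simpleNoiseIntegral_map g (a * ·) (fun b _ hb =>
    SimpleFunc.measure_fiber_lt_top hg (by rintro rfl; simp at hb))] with ω h1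
  rw [h1, simpleNoiseIntegral, Finset.mul_sum]
  exact Finset.sum_congr rfl fun b _ => by ring

theorem laplace_simpleNoiseIntegral [IsProbabilityMeasure P] (hα : 0 < α)
    (hM : IsPositiveStableNoise P α M)
    {g : SimpleFunc (EuclideanSpace ℝ (Fin k)) ℝ} (hg : volume (Function.support g) < ∞)
    (h0 : ∀ s, 0 ≤ g s) :
    ∫ ω, Real.exp (-simpleNoiseIntegral M g ω) ∂P = Real.exp (-∫ s, g s ^ α) := by
  classical
  let s := g.range.filter (· ≠ 0)
  have hs : ∀ c : s, (c : ℝ) ≠ 0 := fun c => (Finset.mem_filter.1 c.2).2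
  have hs0 : ∀ c : s, 0 ≤ (c : ℝ) := fun c => by
    obtain ⟨x, hx⟩ := SimpleFunc.mem_range.1 (Finset.mem_filter.1 c.2).1
    exact hx ▸ h0 x
  have hsum : ∀ φ : ℝ → ℝ, φ 0 = 0 → ∑ c ∈ g.range, φ c = ∑ c : s, φ c := fun φ hφ => by
    rw [Finset.sum_coe_sort s, Finset.sum_filter_of_ne]
    rintro c _ hc rfl
    exact hc hφ
  have hind : iIndepFun (fun c : s => M (g ⁻¹' {(c : ℝ)})) P := by
    have e := (Fintype.equivFin s).symm
    refine iIndepFun.of_precomp (g := e) e.surjective ?_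
    exact hM.indep _ (fun i => g ⁻¹' {((e i : s) : ℝ)}) (fun i => g.measurableSet_fiber _)
      (fun i => SimpleFunc.measure_fiber_lt_top hg (hs _))
      (fun i j hij => Disjoint.preimage g (by
        simpa [Subtype.coe_inj] using hij))
  have hm : ∀ c : s, Measurable (M (g ⁻¹' {(c : ℝ)})) := fun c =>
    hM.measurable _ (g.measurableSet_fiber _) (SimpleFunc.measure_fiber_lt_top hg (hs _))
  have hind2 := hind.comp (fun c x => Real.exp (-((c : ℝ) * x))) (fun c => by fun_prop)
  have h1 : ∀ ω, Real.exp (-simpleNoiseIntegral M g ω) =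
      ∏ c : s, Real.exp (-((c : ℝ) * M (g ⁻¹' {(c : ℝ)}) ω)) := fun ω => by
    rw [simpleNoiseIntegral, hsum (fun c => c * M (g ⁻¹' {c}) ω) (by simp), ← Real.exp_sum,
      Finset.sum_neg_distrib]
  have hint : ∫ x, g x ^ α = ∑ c ∈ g.range, volume.real (g ⁻¹' {c}) * c ^ α := by
    have hgi : Integrable g volume := SimpleFunc.integrable_iff.2 fun c hc =>
      SimpleFunc.measure_fiber_lt_top hg hc
    have hgi' : Integrable (g.map (· ^ α)) volume := SimpleFunc.integrable_iff.2 fun c hc => by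
      refine SimpleFunc.measure_fiber_lt_top ((measure_mono fun x hx => ?_).trans_lt hg) hc
      intro hx0
      simp [hx0, hα.ne'] at hx
    have := SimpleFunc.map_integral g (· ^ α) hgi (Real.zero_rpow hα.ne')
    rw [SimpleFunc.integral_eq_integral _ hgi'] at this
    simpa using this
  simp_rw [h1]
  simp only [Function.comp_def] at hind2
  rw [hind2.integral_fun_prod_eq_prod_integral (fun c => by
    have := hm c
    exact (this.const_mul (c : ℝ)).neg.exp.aestronglyMeasurable)]
  rw [hint, hsum (fun c => volume.real (g ⁻¹' {c}) * c ^ α) (by simp [hα.ne']),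
    ← Finset.sum_neg_distrib, Real.exp_sum]
  exact Finset.prod_congr rfl fun c _ => hM.laplace _ (g.measurableSet_fiber _)
    (SimpleFunc.measure_fiber_lt_top hg (hs _)) c (hs0 c)

end IsPositiveStableNoise

/-! ### Convergence in `L_α` and in probability -/

/-- Subadditivity of the power `α ≤ 1`, applied to `a = (a - b) + b`. It turns convergence in `L_α`
into `L¹` convergence of the `α`-th powers. -/
theorem Real.abs_rpow_sub_rpow_le {α a b : ℝ} (hα : 0 ≤ α) (hα1 : α ≤ 1) (ha : 0 ≤ a)
    (hb : 0 ≤ b) : |a ^ α - b ^ α| ≤ |a - b| ^ α := by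
  wlog h : b ≤ a generalizing a b
  · rw [abs_sub_comm, abs_sub_comm a b]
    exact this hb ha (le_of_not_ge h)
  rw [abs_of_nonneg (sub_nonneg.2 (Real.rpow_le_rpow hb h hα)), abs_of_nonneg (sub_nonneg.2 h)]
  have := Real.rpow_add_le_add_rpow (sub_nonneg.2 h) hb hα hα1
  rw [sub_add_cancel] at this
  linarith

theorem tendsto_lintegral_rpow_enorm {X : Type*} [MeasurableSpace X] {ν : Measure X} {α : ℝ}
    (hα : 0 < α) {F : ℕ → X → ℝ}
    (h : Tendsto (fun n => eLpNorm (F n) (ENNReal.ofReal α) ν) atTop (𝓝 0)) :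
    Tendsto (fun n => ∫⁻ x, ‖F n x‖ₑ ^ α ∂ν) atTop (𝓝 0) := by
  have h0 : ENNReal.ofReal α ≠ 0 := by simpa using hα
  have h1 := (ENNReal.continuous_rpow_const (y := α)).tendsto 0 |>.comp h
  rw [ENNReal.zero_rpow_of_pos hα] at h1
  refine h1.congr fun n => ?_
  rw [Function.comp_apply, eLpNorm_eq_lintegral_rpow_enorm_toReal h0 ENNReal.ofReal_ne_top,
    ENNReal.toReal_ofReal hα.le,
    ← ENNReal.rpow_mul, one_div, inv_mul_cancel₀ hα.ne', ENNReal.rpow_one]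

theorem tendsto_eLpNorm_of_lintegral_rpow_enorm {X : Type*} [MeasurableSpace X] {ν : Measure X}
    {α : ℝ} (hα : 0 < α) {F : ℕ → X → ℝ}
    (h : Tendsto (fun n => ∫⁻ x, ‖F n x‖ₑ ^ α ∂ν) atTop (𝓝 0)) :
    Tendsto (fun n => eLpNorm (F n) (ENNReal.ofReal α) ν) atTop (𝓝 0) := by
  have h0 : ENNReal.ofReal α ≠ 0 := by simpa using hα
  have h1 := (ENNReal.continuous_rpow_const (y := 1 / α)).tendsto 0 |>.comp h
  rw [ENNReal.zero_rpow_of_pos (by positivity)] at h1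
  refine h1.congr fun n => ?_
  rw [Function.comp_apply, eLpNorm_eq_lintegral_rpow_enorm_toReal h0 ENNReal.ofReal_ne_top,
    ENNReal.toReal_ofReal hα.le]

theorem tendsto_integral_rpow_of_eLpNorm {X : Type*} [MeasurableSpace X] {ν : Measure X} {α : ℝ}
    (hα : 0 < α) (hα1 : α ≤ 1) {F : ℕ → X → ℝ} {f : X → ℝ} (hF0 : ∀ n x, 0 ≤ F n x)
    (hf0 : ∀ x, 0 ≤ f x) (hf : AEStronglyMeasurable f ν)
    (hF : ∀ n, Integrable (fun x => F n x ^ α) ν)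
    (h : Tendsto (fun n => eLpNorm (fun x => F n x - f x) (ENNReal.ofReal α) ν) atTop (𝓝 0)) :
    Tendsto (fun n => ∫ x, F n x ^ α ∂ν) atTop (𝓝 (∫ x, f x ^ α ∂ν)) := by
  refine tendsto_integral_of_L1 _ (hf.aemeasurable.pow_const α).aestronglyMeasurable
    (Eventually.of_forall hF) ?_
  refine tendsto_of_tendsto_of_tendsto_of_le_of_le tendsto_const_nhds
    (tendsto_lintegral_rpow_enorm hα h) (fun _ => zero_le) fun n => lintegral_mono fun x => ?_
  have := Real.abs_rpow_sub_rpow_le hα.le hα1 (hF0 n x) (hf0 x)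
  rw [Real.enorm_eq_ofReal_abs, Real.enorm_eq_ofReal_abs,
    ENNReal.ofReal_rpow_of_nonneg (abs_nonneg _) hα.le]
  exact ENNReal.ofReal_le_ofReal this

/-- Under a finite measure, convergence in measure means that every subsequence has a further one
converging almost everywhere; sums respect the latter. -/
theorem MeasureTheory.TendstoInMeasure.add_real {Ω : Type*} [MeasurableSpace Ω]
    {P : Measure Ω} [IsFiniteMeasure P]
    {F F' : ℕ → Ω → ℝ} {f f' : Ω → ℝ} (hF : ∀ n, AEStronglyMeasurable (F n) P)
    (hF' : ∀ n, AEStronglyMeasurable (F' n) P) (h : TendstoInMeasure P F atTop f)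
    (h' : TendstoInMeasure P F' atTop f') :
    TendstoInMeasure P (fun n ω => F n ω + F' n ω) atTop (fun ω => f ω + f' ω) := by
  refine (exists_seq_tendstoInMeasure_atTop_iff fun n => (hF n).add (hF' n)).2 fun ns hns => ?_
  obtain ⟨a, ha, ha'⟩ := (exists_seq_tendstoInMeasure_atTop_iff hF).1 h ns hns
  obtain ⟨b, hb, hb'⟩ := (exists_seq_tendstoInMeasure_atTop_iff hF').1 h' (ns ∘ a) (hns.comp ha)
  refine ⟨a ∘ b, ha.comp hb, ?_⟩
  filter_upwards [ha', hb'] with ω h1 h2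
  exact (h1.comp hb.tendsto_atTop).add h2

theorem MeasureTheory.TendstoInMeasure.const_mul_real {Ω : Type*} [MeasurableSpace Ω]
    {P : Measure Ω} [IsFiniteMeasure P]
    {F : ℕ → Ω → ℝ} {f : Ω → ℝ} (hF : ∀ n, AEStronglyMeasurable (F n) P)
    (h : TendstoInMeasure P F atTop f) (c : ℝ) :
    TendstoInMeasure P (fun n ω => c * F n ω) atTop (fun ω => c * f ω) := by
  refine (exists_seq_tendstoInMeasure_atTop_iff fun n => (hF n).const_mul c).2 fun ns hns => ?_
  obtain ⟨a, ha, ha'⟩ := (exists_seq_tendstoInMeasure_atTop_iff hF).1 h ns hns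
  refine ⟨a, ha, ?_⟩
  filter_upwards [ha'] with ω h1
  exact h1.const_mul c

/-! ### Laplace functional and linearity of the stochastic integral -/

namespace IsPositiveStableNoise

variable {Ω : Type*} [MeasurableSpace Ω] {P : Measure Ω} {α : ℝ} {k : ℕ}
  {M : Set (EuclideanSpace ℝ (Fin k)) → Ω → ℝ}

theorem aestronglyMeasurable_simpleNoiseIntegral (hM : IsPositiveStableNoise P α M)
    {g : SimpleFunc (EuclideanSpace ℝ (Fin k)) ℝ} (hg : volume (Function.support g) < ∞) :
    AEStronglyMeasurable (simpleNoiseIntegral M g) P :=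
  ((measurable_simpleNoiseIntegral M hg).mono hM.noiseSigmaAlgebra_le le_rfl).aestronglyMeasurable

end IsPositiveStableNoise

namespace IsNoiseIntegral

variable {Ω : Type*} [MeasurableSpace Ω] {P : Measure Ω} {α : ℝ} {k : ℕ}
  {M : Set (EuclideanSpace ℝ (Fin k)) → Ω → ℝ}
  {f f' : EuclideanSpace ℝ (Fin k) → ℝ} {I I' : Ω → ℝ}

theorem ae_nonneg (h : IsNoiseIntegral P α M f I) (hM : IsPositiveStableNoise P α M) :
    ∀ᵐ ω ∂P, 0 ≤ I ω := by
  obtain ⟨_, g, hg0, hgs, _, hgI⟩ := h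
  obtain ⟨ns, _, hns⟩ := hgI.exists_seq_tendsto_ae
  filter_upwards [hns,
    ae_all_iff.2 fun n => hM.simpleNoiseIntegral_nonneg (hgs n) (hg0 n)] with ω h1 h2
  exact ge_of_tendsto' h1 fun n => h2 _

/-- The limsup of an almost surely convergent subsequence of simple integrals serves as version. -/
theorem exists_measurable (h : IsNoiseIntegral P α M f I) :
    ∃ J : Ω → ℝ, Measurable[noiseSigmaAlgebra M] J ∧ J =ᵐ[P] I := by
  obtain ⟨_, g, _, hgs, _, hgI⟩ := h
  obtain ⟨ns, _, hns⟩ := hgI.exists_seq_tendsto_ae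
  refine ⟨fun ω => limsup (fun n => simpleNoiseIntegral M (g (ns n)) ω) atTop,
    Measurable.limsup fun n => measurable_simpleNoiseIntegral M (hgs _), ?_⟩
  filter_upwards [hns] with ω h1
  exact h1.limsup_eq

theorem laplace [IsProbabilityMeasure P] (h : IsNoiseIntegral P α M f I) (hα : 0 < α)
    (hα1 : α ≤ 1) (hM : IsPositiveStableNoise P α M) (hf0 : ∀ s, 0 ≤ f s)
    (hf : AEStronglyMeasurable f volume) :
    ∫ ω, Real.exp (-I ω) ∂P = Real.exp (-∫ s, f s ^ α) := by
  obtain ⟨_, g, hg0, hgs, hgf, hgI⟩ := h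
  obtain ⟨ns, hns, hlim⟩ := hgI.exists_seq_tendsto_ae
  have h1 : Tendsto (fun n => ∫ ω, Real.exp (-simpleNoiseIntegral M (g (ns n)) ω) ∂P) atTop
      (𝓝 (∫ ω, Real.exp (-I ω) ∂P)) := by
    -- The simple integrals are almost surely nonnegative, so the exponentials are bounded by `1`.
    refine tendsto_integral_of_dominated_convergence (fun _ => 1) (fun n =>
      Real.continuous_exp.comp_aestronglyMeasurable
        (hM.aestronglyMeasurable_simpleNoiseIntegral (hgs _)).neg) (integrable_const 1)
      (fun n => ?_) ?_
    · filter_upwards [hM.simpleNoiseIntegral_nonneg (hgs (ns n)) (hg0 (ns n))] with ω hω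
      simpa using hω
    · filter_upwards [hlim] with ω hω
      exact (Real.continuous_exp.tendsto _).comp hω.neg
  have h2 : Tendsto (fun n => Real.exp (-∫ s, g (ns n) s ^ α)) atTop
      (𝓝 (Real.exp (-∫ s, f s ^ α))) := by
    refine (Real.continuous_exp.tendsto _).comp (Tendsto.neg ?_)
    refine (tendsto_integral_rpow_of_eLpNorm hα hα1 hg0 hf0 hf (fun n => ?_) hgf).comp
      hns.tendsto_atTop
    have : Integrable ((g n).map (· ^ α)) volume := SimpleFunc.integrable_iff.2 fun c hc =>
      SimpleFunc.measure_fiber_lt_top ((measure_mono fun x hx hx0 => by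
        simp [hx0, hα.ne'] at hx).trans_lt (hgs n)) hc
    exact this
  refine tendsto_nhds_unique h1 (h2.congr fun n => ?_)
  rw [hM.laplace_simpleNoiseIntegral hα (hgs _) (hg0 _)]

theorem add [IsFiniteMeasure P] (h : IsNoiseIntegral P α M f I) (h' : IsNoiseIntegral P α M f' I')
    (hM : IsPositiveStableNoise P α M)
    (hf : AEStronglyMeasurable f volume) (hf' : AEStronglyMeasurable f' volume) :
    IsNoiseIntegral P α M (fun s => f s + f' s) (fun ω => I ω + I' ω) := by
  obtain ⟨hIm, g, hg0, hgs, hgf, hgI⟩ := h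
  obtain ⟨hIm', g', hg0', hgs', hgf', hgI'⟩ := h'
  refine ⟨hIm.add hIm', fun n => g n + g' n, fun n s => add_nonneg (hg0 n s) (hg0' n s),
    fun n => (measure_mono (Function.support_add (g n) (g' n))).trans_lt
      (measure_union_lt_top (hgs n) (hgs' n)), ?_, ?_⟩
  -- For `α < 1` the triangle inequality in `L_α` holds only up to the constant `LpAddConst`.
  · have hz := ENNReal.Tendsto.const_mul (a := ENNReal.LpAddConst (ENNReal.ofReal α)) (hgf.add hgf')
      (Or.inr (ENNReal.LpAddConst_lt_top _).ne)
    rw [add_zero, mul_zero] at hz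
    refine tendsto_of_tendsto_of_tendsto_of_le_of_le tendsto_const_nhds hz
      (fun _ => zero_le) fun n => ?_
    refine le_trans (le_of_eq ?_) (eLpNorm_add_le' ((g n).aestronglyMeasurable.sub hf)
      ((g' n).aestronglyMeasurable.sub hf') _)
    congr 1
    ext s
    simp only [SimpleFunc.coe_add, Pi.add_apply, Pi.sub_apply]
    ring
  · refine (TendstoInMeasure.add_real
      (fun n => hM.aestronglyMeasurable_simpleNoiseIntegral (hgs n))
      (fun n => hM.aestronglyMeasurable_simpleNoiseIntegral (hgs' n)) hgI hgI').congr_left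
      fun n => ?_
    filter_upwards [hM.simpleNoiseIntegral_add (hgs n) (hgs' n)] with ω hω
    exact hω.symm

theorem const_mul [IsFiniteMeasure P] (h : IsNoiseIntegral P α M f I)
    (hM : IsPositiveStableNoise P α M) {a : ℝ} (ha : 0 ≤ a) :
    IsNoiseIntegral P α M (fun s => a * f s) (fun ω => a * I ω) := by
  obtain ⟨hIm, g, hg0, hgs, hgf, hgI⟩ := h
  refine ⟨hIm.const_mul a, fun n => (g n).map (a * ·), fun n s => mul_nonneg ha (hg0 n s),
    fun n => (measure_mono fun s hs hs0 => ?_).trans_lt (hgs n), ?_, ?_⟩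
  · simp [hs0] at hs
  · have hz := ENNReal.Tendsto.const_mul (a := ‖a‖ₑ) hgf (Or.inr enorm_ne_top)
    rw [mul_zero] at hz
    refine hz.congr fun n => ?_
    rw [← eLpNorm_const_smul]
    congr 1
    ext s
    simp [mul_sub]
  · refine (TendstoInMeasure.const_mul_real
      (fun n => hM.aestronglyMeasurable_simpleNoiseIntegral (hgs n)) hgI a).congr_left fun n => ?_
    filter_upwards [hM.simpleNoiseIntegral_const_mul a (hgs n)] with ω hω
    exact hω.symm

theorem zero : IsNoiseIntegral P α M (fun _ => 0) (fun _ => 0) := by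
  have h0 : simpleNoiseIntegral M 0 = fun _ => 0 := by
    ext ω
    refine Finset.sum_eq_zero fun c hc => ?_
    obtain ⟨s, rfl⟩ := SimpleFunc.mem_range.1 hc
    simp
  refine ⟨measurable_const, fun _ => 0, fun _ _ => le_rfl, fun _ => by simp, by simp, ?_⟩
  intro ε hε
  simp [h0, hε.ne']

theorem sum [IsFiniteMeasure P] (hM : IsPositiveStableNoise P α M) {ι : Type*} (s : Finset ι)
    {F : ι → EuclideanSpace ℝ (Fin k) → ℝ} {J : ι → Ω → ℝ}
    (h : ∀ i ∈ s, IsNoiseIntegral P α M (F i) (J i))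
    (hF : ∀ i ∈ s, AEStronglyMeasurable (F i) volume) :
    IsNoiseIntegral P α M (fun x => ∑ i ∈ s, F i x) (fun ω => ∑ i ∈ s, J i ω) := by
  classical
  induction s using Finset.induction_on with
  | empty => simpa using zero
  | insert i s hi ih =>
    simp only [Finset.sum_insert hi]
    exact (h i (Finset.mem_insert_self i s)).add
      (ih (fun j hj => h j (Finset.mem_insert_of_mem hj))
        fun j hj => hF j (Finset.mem_insert_of_mem hj)) hM (hF i (Finset.mem_insert_self i s))
      (Finset.aestronglyMeasurable_fun_sum s fun j hj => hF j (Finset.mem_insert_of_mem hj))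

end IsNoiseIntegral

/-! ### Existence of the stochastic integral -/

/-- A nonnegative function in `L_α` is the limit in `L_α` of an increasing sequence of nonnegative
simple functions below it. -/
theorem exists_monotone_simpleFunc_tendsto {X : Type*} [MeasurableSpace X] {ν : Measure X} {α : ℝ}
    (hα : 0 < α) {f : X → ℝ} (hf0 : ∀ x, 0 ≤ f x) (hfm : Measurable f)
    (hf : MemLp f (ENNReal.ofReal α) ν) :
    ∃ g : ℕ → SimpleFunc X ℝ, (∀ n x, 0 ≤ g n x) ∧ (∀ n x, g n x ≤ f x) ∧
      (∀ n x, g n x ≤ g (n + 1) x) ∧ (∀ n, ν (Function.support (g n)) < ∞) ∧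
      Tendsto (fun n => eLpNorm (fun x => g n x - f x) (ENNReal.ofReal α) ν) atTop (𝓝 0) := by
  let q : X → ℝ≥0∞ := fun x => ENNReal.ofReal (f x)
  have hq : Measurable q := hfm.ennreal_ofReal
  have hle : ∀ n x, SimpleFunc.eapprox q n x ≤ q x := fun n x => by
    rw [← SimpleFunc.iSup_eapprox_apply hq x]
    exact le_iSup (fun n => SimpleFunc.eapprox q n x) n
  let g : ℕ → SimpleFunc X ℝ := fun n => (SimpleFunc.eapprox q n).map ENNReal.toReal
  have hg0 : ∀ n x, 0 ≤ g n x := fun n x => ENNReal.toReal_nonneg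
  have hgf : ∀ n x, g n x ≤ f x := fun n x => by
    have := ENNReal.toReal_mono ENNReal.ofReal_ne_top (hle n x)
    rwa [ENNReal.toReal_ofReal (hf0 x)] at this
  have hlim : ∀ x, Tendsto (fun n => g n x) atTop (𝓝 (f x)) := fun x => by
    have := (ENNReal.tendsto_toReal (ENNReal.ofReal_ne_top (r := f x))).comp
      (SimpleFunc.tendsto_eapprox hq x)
    rwa [ENNReal.toReal_ofReal (hf0 x)] at this
  have hα0 : ENNReal.ofReal α ≠ 0 := by simpa using hα
  refine ⟨g, hg0, hgf, fun n x => ENNReal.toReal_mono (SimpleFunc.eapprox_lt_top q _ x).ne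
    (SimpleFunc.monotone_eapprox q n.le_succ x), fun n => ?_, ?_⟩
  · refine SimpleFunc.measure_support_lt_top_of_memLp (g n) (hf.mono (g n).aestronglyMeasurable
      (ae_of_all _ fun x => ?_)) hα0 ENNReal.ofReal_ne_top
    rw [Real.norm_of_nonneg (hg0 n x), Real.norm_of_nonneg (hf0 x)]
    exact hgf n x
  · refine tendsto_eLpNorm_of_lintegral_rpow_enorm hα ?_
    have hfin := lintegral_rpow_enorm_lt_top_of_eLpNorm_lt_top hα0 ENNReal.ofReal_ne_top hf.2
    rw [ENNReal.toReal_ofReal hα.le] at hfin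
    have := tendsto_lintegral_of_dominated_convergence (μ := ν)
      (F := fun n x => ‖g n x - f x‖ₑ ^ α) (f := fun _ => 0) (fun x => ‖f x‖ₑ ^ α)
      (fun n => (((g n).measurable.sub hfm).enorm.pow_const α))
      (fun n => ae_of_all _ fun x => by
        dsimp only
        gcongr
        rw [Real.enorm_eq_ofReal_abs, Real.enorm_eq_ofReal_abs]
        refine ENNReal.ofReal_le_ofReal ?_
        rw [abs_of_nonpos (sub_nonpos.2 (hgf n x)), abs_of_nonneg (hf0 x)]
        linarith [hg0 n x]) hfin.ne
      (ae_of_all _ fun x => by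
        have h1 := (((hlim x).sub_const (f x)).enorm).ennrpow_const α
        simpa [hα] using h1)
    simpa using this

namespace IsPositiveStableNoise

variable {Ω : Type*} [MeasurableSpace Ω] {P : Measure Ω} {α : ℝ} {k : ℕ}
  {M : Set (EuclideanSpace ℝ (Fin k)) → Ω → ℝ}

theorem simpleNoiseIntegral_mono (hM : IsPositiveStableNoise P α M)
    {g h : SimpleFunc (EuclideanSpace ℝ (Fin k)) ℝ} (hg : volume (Function.support g) < ∞)
    (hh : volume (Function.support h) < ∞) (hgh : ∀ s, g s ≤ h s) :
    ∀ᵐ ω ∂P, simpleNoiseIntegral M g ω ≤ simpleNoiseIntegral M h ω := by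
  have hs : volume (Function.support (h - g)) < ∞ :=
    (measure_mono (Function.support_sub h g)).trans_lt (measure_union_lt_top hh hg)
  filter_upwards [hM.simpleNoiseIntegral_add hg hs,
    hM.simpleNoiseIntegral_nonneg hs fun s => sub_nonneg.2 (hgh s)] with ω h1 h2
  rw [add_sub_cancel] at h1
  linarith

/-- The integrals of an increasing sequence of simple functions are almost surely bounded if the
`L_α` norms are. -/
theorem ae_bddAbove_simpleNoiseIntegral [IsProbabilityMeasure P] (hα : 0 < α)
    (hM : IsPositiveStableNoise P α M) {g : ℕ → SimpleFunc (EuclideanSpace ℝ (Fin k)) ℝ}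
    (hg0 : ∀ n s, 0 ≤ g n s) (hgs : ∀ n, volume (Function.support (g n)) < ∞)
    (hmono : ∀ n s, g n s ≤ g (n + 1) s) {C : ℝ} (hC : ∀ n, ∫ s, g n s ^ α ≤ C) :
    ∀ᵐ ω ∂P, BddAbove (Set.range fun n => simpleNoiseIntegral M (g n) ω) := by
  have hm : ∀ n, Measurable (simpleNoiseIntegral M (g n)) := fun n =>
    (measurable_simpleNoiseIntegral M (hgs n)).mono hM.noiseSigmaAlgebra_le le_rfl
  have hmono' : ∀ᵐ ω ∂P, Monotone fun n => simpleNoiseIntegral M (g n) ω := by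
    filter_upwards [ae_all_iff.2 fun n =>
      hM.simpleNoiseIntegral_mono (hgs n) (hgs (n + 1)) (hmono n)] with ω hω
    exact monotone_nat_of_le_succ hω
  have hnn : ∀ᵐ ω ∂P, ∀ n, 0 ≤ simpleNoiseIntegral M (g n) ω :=
    ae_all_iff.2 fun n => hM.simpleNoiseIntegral_nonneg (hgs n) (hg0 n)
  set B : Set Ω := {ω | BddAbove (Set.range fun n => simpleNoiseIntegral M (g n) ω)}
  have hB : MeasurableSet B := measurableSet_bddAbove_range hm
  -- Off `B` the monotone integrals tend to infinity and their exponentials to `0`, so in the limit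
  -- only `B` contributes to the Laplace transform. Letting `θ` decrease to `0` then gives `P B =
  -- 1`.
  have hlow : ∀ θ : ℝ, 0 < θ → Real.exp (-(θ ^ α * C)) ≤ P.real B := by
    intro θ hθ
    have hexp : ∀ n, Real.exp (-(θ ^ α * C)) ≤
        ∫ ω, Real.exp (-(θ * simpleNoiseIntegral M (g n) ω)) ∂P := by
      intro n
      have hs : volume (Function.support ((g n).map (θ * ·))) < ∞ :=
        (measure_mono fun s hs hs0 => by simp [hs0] at hs).trans_lt (hgs n)
      have h1 := hM.laplace_simpleNoiseIntegral hα hs fun s => mul_nonneg hθ.le (hg0 n s)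
      have h2 : ∫ ω, Real.exp (-simpleNoiseIntegral M ((g n).map (θ * ·)) ω) ∂P =
          ∫ ω, Real.exp (-(θ * simpleNoiseIntegral M (g n) ω)) ∂P := by
        refine integral_congr_ae ?_
        filter_upwards [hM.simpleNoiseIntegral_const_mul θ (hgs n)] with ω hω
        rw [hω]
      rw [← h2, h1]
      simp only [SimpleFunc.map_apply, Real.mul_rpow hθ.le (hg0 n _)]
      rw [integral_const_mul]
      gcongr
      exact hC n
    have hint : ∀ n, Integrable (fun ω => Real.exp (-(θ * simpleNoiseIntegral M (g n) ω))) P := by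
      intro n
      refine Integrable.of_bound (((hm n).const_mul θ).neg.exp).aestronglyMeasurable 1 ?_
      filter_upwards [hnn] with ω hω
      have := mul_nonneg hθ.le (hω n)
      simpa using this
    have hlim : Tendsto (fun n => ∫ ω in Bᶜ, Real.exp (-(θ * simpleNoiseIntegral M (g n) ω)) ∂P)
        atTop (𝓝 (∫ ω in Bᶜ, 0 ∂P)) := by
      refine tendsto_integral_of_dominated_convergence (fun _ => 1)
        (fun n => (((hm n).const_mul θ).neg.exp).aestronglyMeasurable) (integrable_const 1)
        (fun n => ?_) ?_
      · filter_upwards [ae_restrict_of_ae hnn] with ω hω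
        have := mul_nonneg hθ.le (hω n)
        simpa using this
      · filter_upwards [ae_restrict_of_ae hmono', ae_restrict_mem hB.compl] with ω hω hωB
        refine Real.tendsto_exp_neg_atTop_nhds_zero.comp (Tendsto.const_mul_atTop hθ ?_)
        exact tendsto_atTop_atTop_of_monotone' hω hωB
    rw [integral_zero] at hlim
    have hlim' := hlim.const_add (P.real B)
    rw [add_zero] at hlim'
    refine ge_of_tendsto' hlim' fun n => (hexp n).trans ?_
    rw [← integral_add_compl hB (hint n)]
    gcongr
    calc ∫ ω in B, Real.exp (-(θ * simpleNoiseIntegral M (g n) ω)) ∂P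
        ≤ ∫ ω in B, 1 ∂P := by
          refine integral_mono_ae (hint n).integrableOn (integrable_const 1) ?_
          filter_upwards [ae_restrict_of_ae hnn] with ω hω
          have := mul_nonneg hθ.le (hω n)
          simpa using this
      _ = P.real B := by simp
  have hone : 1 ≤ P.real B := by
    have hc : Tendsto (fun θ : ℝ => Real.exp (-(θ ^ α * C))) (𝓝[>] 0) (𝓝 1) := by
      have h1 : Tendsto (fun θ : ℝ => θ ^ α) (𝓝[>] 0) (𝓝 0) := by
        have := (Real.continuousAt_rpow_const 0 α (Or.inr hα.le)).tendsto
        rw [Real.zero_rpow hα.ne'] at this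
        exact this.mono_left nhdsWithin_le_nhds
      have := (Real.continuous_exp.tendsto _).comp (h1.mul_const C).neg
      simpa [Function.comp_def] using this
    refine le_of_tendsto hc ?_
    filter_upwards [self_mem_nhdsWithin] with θ hθ using hlow θ hθ
  refine (mem_ae_iff_prob_eq_one hB).2 (le_antisymm prob_le_one ?_)
  rwa [← ENNReal.ofReal_one, ENNReal.ofReal_le_iff_le_toReal (measure_ne_top P B)]

theorem exists_isNoiseIntegral [IsProbabilityMeasure P] (hα : 0 < α)
    (hM : IsPositiveStableNoise P α M) {f : EuclideanSpace ℝ (Fin k) → ℝ} (hf0 : ∀ s, 0 ≤ f s)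
    (hf : MemLp f (ENNReal.ofReal α) volume) : ∃ I, IsNoiseIntegral P α M f I := by
  -- A measurable representative of `f` that is nonnegative everywhere.
  let f' : EuclideanSpace ℝ (Fin k) → ℝ := fun s => max (hf.1.mk f s) 0
  have hff' : f =ᵐ[volume] f' := by
    filter_upwards [hf.1.ae_eq_mk] with s hs
    simp only [f', ← hs, max_eq_left (hf0 s)]
  have hf'm : Measurable f' := hf.1.stronglyMeasurable_mk.measurable.max measurable_const
  have hf'0 : ∀ s, 0 ≤ f' s := fun s => le_max_right _ _
  have hf' : MemLp f' (ENNReal.ofReal α) volume := (memLp_congr_ae hff').1 hf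
  obtain ⟨g, hg0, hgf, hmono, hgs, hlim⟩ := exists_monotone_simpleFunc_tendsto hα hf'0 hf'm hf'
  have hint : Integrable (fun s => f' s ^ α) volume := by
    have := hf'.integrable_norm_rpow (by simpa using hα) ENNReal.ofReal_ne_top
    simpa only [Real.norm_of_nonneg (hf'0 _), ENNReal.toReal_ofReal hα.le] using this
  have hbdd := hM.ae_bddAbove_simpleNoiseIntegral hα hg0 hgs hmono (C := ∫ s, f' s ^ α) fun n =>
    integral_mono_of_nonneg (ae_of_all _ fun s => Real.rpow_nonneg (hg0 n s) α) hint
      (ae_of_all _ fun s => Real.rpow_le_rpow (hg0 n s) (hgf n s) hα.le)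
  have hm : ∀ n, Measurable (simpleNoiseIntegral M (g n)) := fun n =>
    (measurable_simpleNoiseIntegral M (hgs n)).mono hM.noiseSigmaAlgebra_le le_rfl
  refine ⟨fun ω => ⨆ n, simpleNoiseIntegral M (g n) ω, Measurable.iSup hm, g, hg0, hgs, ?_, ?_⟩
  · refine hlim.congr fun n => eLpNorm_congr_ae ?_
    filter_upwards [hff'] with s hs
    rw [hs]
  · refine tendstoInMeasure_of_tendsto_ae (fun n => (hm n).aestronglyMeasurable) ?_
    filter_upwards [hbdd, ae_all_iff.2 fun n =>
      hM.simpleNoiseIntegral_mono (hgs n) (hgs (n + 1)) (hmono n)] with ω hω hω'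
    exact tendsto_atTop_ciSup (monotone_nat_of_le_succ hω') hω

theorem isNoiseIntegral_noiseIntegral [IsProbabilityMeasure P] (hα : 0 < α)
    (hM : IsPositiveStableNoise P α M) {f : EuclideanSpace ℝ (Fin k) → ℝ} (hf0 : ∀ s, 0 ≤ f s)
    (hf : MemLp f (ENNReal.ofReal α) volume) :
    IsNoiseIntegral P α M f (noiseIntegral P α M f) := by
  have h := hM.exists_isNoiseIntegral hα hf0 hf
  rw [noiseIntegral, dif_pos h]
  exact h.choose_spec

end IsPositiveStableNoise

/-! ### Independence and the Gumbel shift -/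

theorem ProbabilityTheory.iIndep.iIndepFun_of_measurable {Ω ι : Type*} [MeasurableSpace Ω]
    {P : Measure Ω} {m : ι → MeasurableSpace Ω} {β : ι → Type*} [∀ i, MeasurableSpace (β i)]
    {Z : ∀ i, Ω → β i} (h : iIndep m P) (hZ : ∀ i, Measurable[m i] (Z i)) : iIndepFun Z P := by
  rw [iIndepFun_iff_iIndep, iIndep_iff]
  exact fun s A hA => h.meas_biInter fun i hi => (hZ i).comap_le _ (hA i hi)

/-- The two index ranges are disjoint, so the σ-algebras they generate are independent. This
separates all noise integrals from all Gumbel variables. -/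
theorem ProbabilityTheory.iIndep.indepFun_sum {Ω ι κ : Type*} [mΩ : MeasurableSpace Ω]
    {P : Measure Ω} {m : ι → MeasurableSpace Ω} {m' : κ → MeasurableSpace Ω} {β γ : Type*}
    [MeasurableSpace β] [MeasurableSpace γ] {Y : ι → Ω → β} {Z : κ → Ω → γ} (h : iIndep (Sum.elim m m') P)
    (hm : ∀ i, m i ≤ mΩ) (hm' : ∀ i, m' i ≤ mΩ) (hY : ∀ i, Measurable[m i] (Y i))
    (hZ : ∀ i, Measurable[m' i] (Z i)) :
    IndepFun (fun ω i => Y i ω) (fun ω i => Z i ω) P := by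
  have hle : ∀ i, Sum.elim m m' i ≤ mΩ := by
    rintro (i | i)
    exacts [hm i, hm' i]
  have hind := indep_iSup_of_disjoint hle h
    (Set.isCompl_range_inl_range_inr (α := ι) (β := κ)).disjoint
  rw [IndepFun_iff_Indep]
  refine indep_of_indep_of_le_left (indep_of_indep_of_le_right hind ?_) ?_
  · refine Measurable.comap_le (@measurable_pi_lambda _ _ _ (_) _ _ fun i => (hZ i).mono ?_ le_rfl)
    exact le_iSup₂_of_le (Sum.inr i) ⟨i, rfl⟩ le_rfl
  · refine Measurable.comap_le (@measurable_pi_lambda _ _ _ (_) _ _ fun i => (hY i).mono ?_ le_rfl)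
    exact le_iSup₂_of_le (Sum.inl i) ⟨i, rfl⟩ le_rfl

theorem extLog_of_nonpos {y : ℝ} (hy : y ≤ 0) : extLog y = ⊥ := by
  rw [extLog, ENNReal.ofReal_of_nonpos hy, ENNReal.log_zero]

theorem extLog_of_pos {y : ℝ} (hy : 0 < y) : extLog y = Real.log y := by
  rw [extLog, ENNReal.log_ofReal_of_pos hy]

/-- For `w ≤ 0` the left side is `⊥`, while `Real.log w` would be a meaningless default; hence the
disjunction. -/
theorem add_mul_extLog_le_iff {s : ℝ} (hs : 0 < s) (g w x : ℝ) :
    (g : EReal) + (s : EReal) * extLog w ≤ (x : EReal) ↔ w ≤ 0 ∨ g ≤ x - s * Real.log w := by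
  rcases le_or_gt w 0 with hw | hw
  · simp [extLog_of_nonpos hw, EReal.coe_mul_bot_of_pos hs, hw]
  · rw [extLog_of_pos hw, ← EReal.coe_mul, ← EReal.coe_add, EReal.coe_le_coe_iff,
      or_iff_right (not_le.2 hw), le_sub_iff_add_le]

namespace IsGumbel

variable {Ω : Type*} [MeasurableSpace Ω] {P : Measure Ω} {μ σ : ℝ} {Y : Ω → ℝ}

theorem measure_add_mul_log_le [IsProbabilityMeasure P] (hY : IsGumbel P μ σ Y) (hσ : 0 < σ)
    (w x : ℝ) : P.map Y {g | w ≤ 0 ∨ g ≤ x - σ * Real.log w} =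
      ENNReal.ofReal (Real.exp (-(Real.exp (-((x - μ) / σ)) * max w 0))) := by
  rcases le_or_gt w 0 with hw | hw
  · have := Measure.isProbabilityMeasure_map (μ := P) hY.measurable.aemeasurable
    simp [hw]
  · have hset : {g | w ≤ 0 ∨ g ≤ x - σ * Real.log w} = Set.Iic (x - σ * Real.log w) := by
      ext g
      simp [not_le.2 hw]
    rw [hset, Measure.map_apply hY.measurable measurableSet_Iic, max_eq_left hw.le,
      ← ofReal_measureReal]
    congr 1
    refine (hY.cdf _).trans ?_
    have h1 : -((x - σ * Real.log w - μ) / σ) = -((x - μ) / σ) + Real.log w := by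
      field_simp
      ring
    rw [h1, Real.exp_add, Real.exp_log hw]

end IsGumbel

/-- If `Y`, `G` are independent and the coordinates of `G` are independent Gumbel variables, the
distribution function of `G i + σ i * log (w i Y)` is a Laplace transform of `w Y`. -/
theorem measure_forall_gumbel_le {Ω : Type*} [MeasurableSpace Ω] {P : Measure Ω}
    [IsProbabilityMeasure P] {ι E : Type*} [Fintype ι] [MeasurableSpace E] {Y : Ω → E}
    {G : ι → Ω → ℝ} {μ σ : ι → ℝ} (hσ : ∀ i, 0 < σ i) (hY : Measurable Y)
    (hG : ∀ i, IsGumbel P (μ i) (σ i) (G i)) (hGi : iIndepFun G P)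
    (hYG : IndepFun Y (fun ω i => G i ω) P) {w : ι → E → ℝ} (hw : ∀ i, Measurable (w i))
    (x : ι → ℝ) :
    P {ω | ∀ i, (G i ω : EReal) + (σ i : EReal) * extLog (w i (Y ω)) ≤ (x i : EReal)} =
      ∫⁻ ω, ∏ i, ENNReal.ofReal (Real.exp
        (-(Real.exp (-((x i - μ i) / σ i)) * max (w i (Y ω)) 0))) ∂P := by
  have hGm : Measurable fun ω i => G i ω := measurable_pi_lambda _ fun i => (hG i).measurable
  let D : Set (E × (ι → ℝ)) :=
    {p | ∀ i, w i p.1 ≤ 0 ∨ p.2 i ≤ x i - σ i * Real.log (w i p.1)}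
  have hD : MeasurableSet D := by
    have hD' : D = ⋂ i, ({p | w i p.1 ≤ 0} ∪ {p | p.2 i ≤ x i - σ i * Real.log (w i p.1)}) := by
      ext p
      simp [D]
    rw [hD']
    refine MeasurableSet.iInter fun i => MeasurableSet.union ?_ ?_
    · exact measurableSet_le ((hw i).comp measurable_fst) measurable_const
    · exact measurableSet_le (by fun_prop)
        (measurable_const.sub ((((hw i).comp measurable_fst).log).const_mul _))
  have hset : {ω | ∀ i, (G i ω : EReal) + (σ i : EReal) * extLog (w i (Y ω)) ≤ (x i : EReal)} =
      (fun ω => (Y ω, fun i => G i ω)) ⁻¹' D := by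
    ext ω
    simp only [Set.mem_ofPred_eq, Set.mem_preimage, D, add_mul_extLog_le_iff (hσ _)]
  have hprob : ∀ i, IsProbabilityMeasure (P.map (G i)) := fun i =>
    Measure.isProbabilityMeasure_map (hG i).measurable.aemeasurable
  -- By independence the joint law is a product, and Fubini leaves the measure of a section of `D`,
  -- which is a box.
  rw [hset, ← Measure.map_apply (hY.prodMk hGm) hD,
    (indepFun_iff_map_prod_eq_prod_map_map hY.aemeasurable hGm.aemeasurable).1 hYG,
    hGi.map_fun_eq_pi_map fun i => (hG i).measurable.aemeasurable,
    Measure.prod_apply hD, lintegral_map (measurable_measure_prodMk_left hD) hY]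
  refine lintegral_congr fun ω => ?_
  have hsec : Prod.mk (Y ω) ⁻¹' D =
      Set.univ.pi fun i => {g | w i (Y ω) ≤ 0 ∨ g ≤ x i - σ i * Real.log (w i (Y ω))} := by
    ext g
    simp [D]
  rw [hsec, Measure.pi_pi]
  exact Finset.prod_congr rfl fun i _ => (hG i).measure_add_mul_log_le (hσ i) _ _

/-! ### The joint distribution function -/

theorem proposition2 {Ω : Type*} [MeasurableSpace Ω] (P : Measure Ω) [IsProbabilityMeasure P]
    {k l m n : ℕ} (α : ℝ) (hα : 0 < α) (hα1 : α ≤ 1)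
    -- the noises `S_j`
    (S : Fin m → Set (EuclideanSpace ℝ (Fin k)) → Ω → ℝ)
    (hS : ∀ j, IsPositiveStableNoise P α (S j))
    -- the points `t_1, …, t_n`, the parameters and the Gumbel variables `G_t`
    (t : Fin n → EuclideanSpace ℝ (Fin l))
    (μ σ : EuclideanSpace ℝ (Fin l) → ℝ) (hσ : ∀ i, 0 < σ (t i))
    (G : EuclideanSpace ℝ (Fin l) → Ω → ℝ)
    (hG : ∀ i, IsGumbel P (μ (t i)) (σ (t i)) (G (t i)))
    -- `S_1, …, S_m, G_{t_1}, …, G_{t_n}` are mutually independent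
    (hindep : iIndep
      (Sum.elim (fun j : Fin m => noiseSigmaAlgebra (S j))
        (fun i : Fin n => MeasurableSpace.comap (G (t i)) (inferInstance : MeasurableSpace ℝ))) P)
    -- the nonnegative functions `f_j(t, s)`, with convergent integrals
    (f : Fin m → EuclideanSpace ℝ (Fin l) → EuclideanSpace ℝ (Fin k) → ℝ)
    (hf : ∀ j i s, 0 ≤ f j (t i) s)
    (hfα : ∀ j i, MemLp (f j (t i)) (ENNReal.ofReal α) volume)
    (X : EuclideanSpace ℝ (Fin l) → Ω → EReal)
    (hX : ∀ i, ∀ᵐ ω ∂P, X (t i) ω =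
      (G (t i) ω : EReal) +
        (σ (t i) : EReal) * extLog (∑ j, noiseIntegral P α (S j) (f j (t i)) ω))
    (x : Fin n → ℝ) :
    P.real {ω | ∀ i, X (t i) ω ≤ (x i : EReal)} =
      ∏ j, Real.exp (-∫ s,
        (∑ i, f j (t i) s * Real.exp (-((x i - μ (t i)) / σ (t i)))) ^ α) := by
  have hN : ∀ j i, IsNoiseIntegral P α (S j) (f j (t i)) (noiseIntegral P α (S j) (f j (t i))) :=
    fun j i => (hS j).isNoiseIntegral_noiseIntegral hα (hf j i) (hfα j i)
  -- `noiseIntegral` is a chosen version, measurable for the ambient σ-algebra only; `J` replaces it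
  -- so that `hindep` applies.
  choose J hJm hJ using fun j i => (hN j i).exists_measurable
  have hSle : ∀ j, noiseSigmaAlgebra (S j) ≤ ‹MeasurableSpace Ω› := fun j =>
    (hS j).noiseSigmaAlgebra_le
  have hJm' : ∀ j i, Measurable (J j i) := fun j i => (hJm j i).mono (hSle j) le_rfl
  have hJ0 : ∀ᵐ ω ∂P, ∀ j i, 0 ≤ J j i ω := ae_all_iff.2 fun j => ae_all_iff.2 fun i => by
    filter_upwards [hJ j i, (hN j i).ae_nonneg (hS j)] with ω h1 h2
    rwa [h1]
  set c : Fin n → ℝ := fun i => Real.exp (-((x i - μ (t i)) / σ (t i)))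
  have hYm : ∀ j, Measurable[noiseSigmaAlgebra (S j)] fun ω i => J j i ω := fun j =>
    @measurable_pi_lambda _ _ _ (_) _ _ (hJm j)
  have hYG := hindep.indepFun_sum hSle (fun i => (hG i).measurable.comap_le) hYm
    fun i => comap_measurable (G (t i))
  have hGi : iIndepFun (fun i => G (t i)) P :=
    (iIndepFun_iff_iIndep _ _ _).2 (hindep.precomp Sum.inr_injective)
  have hZi : iIndepFun (fun j ω => Real.exp (-∑ i, c i * J j i ω)) P := by
    refine (hindep.precomp Sum.inl_injective).iIndepFun_of_measurable fun j => ?_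
    have : Measurable fun y : Fin n → ℝ => Real.exp (-∑ i, c i * y i) := by fun_prop
    exact this.comp (hYm j)
  have hlap : ∀ j, ∫ ω, Real.exp (-∑ i, c i * J j i ω) ∂P =
      Real.exp (-∫ s, (∑ i, f j (t i) s * c i) ^ α) := by
    intro j
    have h1 : IsNoiseIntegral P α (S j) (fun s => ∑ i, c i * f j (t i) s)
        (fun ω => ∑ i, c i * noiseIntegral P α (S j) (f j (t i)) ω) :=
      IsNoiseIntegral.sum (hS j) Finset.univ
        (fun i _ => (hN j i).const_mul (hS j) (Real.exp_pos _).le)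
        fun i _ => (hfα j i).1.const_mul _
    have h2 := h1.laplace hα hα1 (hS j)
      (fun s => Finset.sum_nonneg fun i _ => mul_nonneg (Real.exp_pos _).le (hf j i s))
      (Finset.aestronglyMeasurable_fun_sum _ fun i _ => (hfα j i).1.const_mul _)
    simp only [mul_comm (f j _ _)]
    rw [← h2]
    refine integral_congr_ae ?_
    filter_upwards [ae_all_iff.2 (hJ j)] with ω hω
    simp only [hω]
  have hev : P {ω | ∀ i, X (t i) ω ≤ (x i : EReal)} = P {ω | ∀ i, (G (t i) ω : EReal) +
      (σ (t i) : EReal) * extLog (∑ j, J j i ω) ≤ (x i : EReal)} := by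
    refine measure_congr ?_
    filter_upwards [ae_all_iff.2 hX, ae_all_iff.2 fun j => ae_all_iff.2 (hJ j)] with ω h1 h2
    refine propext (forall_congr' fun i => ?_)
    rw [h1 i]
    simp only [h2]
  have hmain := measure_forall_gumbel_le (P := P) (Y := fun ω j i => J j i ω)
    (G := fun i => G (t i)) (w := fun i y => ∑ j, y j i) hσ
    (measurable_pi_lambda _ fun j => (hYm j).mono (hSle j) le_rfl) hG hGi hYG
    (fun i => by fun_prop) x
  -- The maximum with `0` disappears only almost surely, since `J` is nonnegative only almost
  -- surely.
  have hprod : ∀ᵐ ω ∂P, ∏ i, ENNReal.ofReal (Real.exp (-(c i * max (∑ j, J j i ω) 0))) =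
      ENNReal.ofReal (∏ j, Real.exp (-∑ i, c i * J j i ω)) := by
    filter_upwards [hJ0] with ω h0
    have hsum : ∑ i, c i * max (∑ j, J j i ω) 0 = ∑ j, ∑ i, c i * J j i ω := by
      rw [Finset.sum_comm]
      refine Finset.sum_congr rfl fun i _ => ?_
      rw [max_eq_left (Finset.sum_nonneg fun j _ => h0 j i), Finset.mul_sum]
    rw [← ENNReal.ofReal_prod_of_nonneg fun i _ => (Real.exp_pos _).le, ← Real.exp_sum,
      ← Real.exp_sum, Finset.sum_neg_distrib, Finset.sum_neg_distrib, hsum]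
  have hZm : ∀ j, Measurable fun ω => Real.exp (-∑ i, c i * J j i ω) := fun j => by fun_prop
  rw [measureReal_def, hev, hmain, lintegral_congr_ae hprod,
    ← integral_eq_lintegral_of_nonneg_ae
      (ae_of_all _ fun ω => Finset.prod_nonneg fun j _ => (Real.exp_pos _).le)
      (Finset.measurable_fun_prod _ fun j _ => hZm j).aestronglyMeasurable,
    hZi.integral_fun_prod_eq_prod_integral fun j => (hZm j).aestronglyMeasurable]
  exact Finset.prod_congr rfl fun j _ => hlap j
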